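/- Let $I^n = [0,1]^n$, and for $i \in \{1,\dots,n\}$ let $I^n_{i,-} = \{z \in I^n : z_i = 0\}$ and $I^n_{i,+} = \{z \in I^n : z_i = 1\}$. A subset $B \subset I^n$ \emph{connects the $i$th opposite faces} of $I^n$ if there is a connected subset $S \subset B$ with $S \cap I^n_{i,-} \neq \emptyset \neq S \cap I^n_{i,+}$; it \emph{separates the $i$th opposite faces} of $I^n$ if $I^n \setminus B$ does not connect the $i$th opposite faces of $I^n$. For a continuous function $g \colon I^n \to \mathbb{R}^m$, let $\mathrm{Conn}_i(g)$ (respectively $\mathrm{Sep}_i(g)$) be the set of all points $p \in \mathbb{R}^m$ such that the fiber $g^{-1}(\{p\})$ connects (respectively separates) the $i$th opposite faces of $I^n$. Theorem. Let $n, m \in \mathbb{N}$ with $n > 1$ and $m > 1$, let $i \in \{1,\dots,n\}$, and let $A \subset \mathbb{R}^m$. Then the following conditions are equivalent: 1. the set $A$ is compact; 2. there exists a continuous function $g \colon I^n \to \mathbb{R}^m$ such that $\mathrm{Conn}_i(g) = A$; 3. there exists a continuous function $g \colon I^n \to \mathbb{R}^m$ such that $\mathrm{Sep}_i(g) = A$.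 -/

import Mathlib

open Set

/-- The unit cube `I^n = [0,1]^n` with its product topology. -/
abbrev UnitCube (n : ℕ) : Type := Fin n → unitInterval

namespace UnitCube

variable {n : ℕ}

/-- The face `{z ∈ I^n : z_i = 0}`. -/
def faceMinus (i : Fin n) : Set (UnitCube n) := {z | z i = 0}

/-- The face `{z ∈ I^n : z_i = 1}`. -/
def facePlus (i : Fin n) : Set (UnitCube n) := {z | z i = 1}

/-- `A ⊆ I^n` connects the `i`th opposite faces: some connected subset of `A` meets both faces. -/
def Connects (i : Fin n) (A : Set (UnitCube n)) : Prop :=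
  ∃ S : Set (UnitCube n), S ⊆ A ∧ IsConnected S ∧
    (S ∩ faceMinus i).Nonempty ∧ (S ∩ facePlus i).Nonempty

/-- `A ⊆ I^n` separates the `i`th opposite faces: `I^n \ A` does not connect them. -/
def Separates (i : Fin n) (A : Set (UnitCube n)) : Prop :=
  ¬ Connects i Aᶜ

/-- The set of all points whose fiber under `g` connects the `i`th opposite faces. -/
def connSet {Y : Type*} (i : Fin n) (g : UnitCube n → Y) : Set Y :=
  {p | Connects i (g ⁻¹' {p})}

/-- The set of all points whose fiber under `g` separates the `i`th opposite faces. -/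
def sepSet {Y : Type*} (i : Fin n) (g : UnitCube n → Y) : Set Y :=
  {p | Separates i (g ⁻¹' {p})}

end UnitCube

/-! Both sets of values lie in the compact range of `g`, so only closedness matters. For `connSet`,
components of a compact fiber are its quasi-components, so an unconnected fiber splits by a clopen
set, and the splitting persists nearby. For `sepSet`, a connection in the open complement of a fiber
can be taken to be a path, whose compact image misses nearby values too.

Conversely, everything reduces to a map of the square (`IsCompact.exists_square_map`), `G x y = F y
+ x * dist (F y, A) • h`. The curve `F` covers `A` and leaves it only along countably many segments,
and `h` is parallel to none of them, which is possible since `m > 1`. Points of `A` do not move with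
`x`. A point `p` outside `A` is hit by each moving segment for at most one `x`, so some `x` avoids
`p` altogether. Swapping the two coordinates exchanges connecting and separating. -/

/-- In a compact Hausdorff space, closed sets `P` and `Q` that no connected set joins are
separated by a clopen set. -/
theorem exists_isClopen_of_forall_isConnected {X : Type*} [TopologicalSpace X] [T2Space X]
    [CompactSpace X] {P Q : Set X} (hP : IsClosed P) (hQ : IsClosed Q)
    (h : ∀ S : Set X, IsConnected S → (S ∩ P).Nonempty → ¬ (S ∩ Q).Nonempty) :
    ∃ V : Set X, IsClopen V ∧ P ⊆ V ∧ Disjoint V Q := by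
  have key : ∀ x : P, ∃ V : Set X, IsClopen V ∧ (x : X) ∈ V ∧ Disjoint V Q := by
    rintro ⟨x, hx⟩
    let ι := {s : Set X // IsClopen s ∧ x ∈ s}
    have : Nonempty ι := ⟨⟨univ, isClopen_univ, mem_univ x⟩⟩
    obtain ⟨⟨V, hV, hxV⟩, hVQ⟩ := exists_subset_nhds_of_isCompact' (V := fun s : ι => (s : Set X))
      (fun s t => ⟨⟨s ∩ t, s.2.1.inter t.2.1, s.2.2, t.2.2⟩, inter_subset_left,
        inter_subset_right⟩)
      (fun s => s.2.1.isClosed.isCompact) (fun s => s.2.1.isClosed) (U := Qᶜ) (by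
        intro y hy
        refine hQ.isOpen_compl.mem_nhds fun hyQ => ?_
        rw [← connectedComponent_eq_iInter_isClopen] at hy
        exact h _ isConnected_connectedComponent ⟨x, mem_connectedComponent, hx⟩ ⟨y, hy, hyQ⟩)
    exact ⟨V, hV, hxV, disjoint_left.2 fun y hy => hVQ hy⟩
  choose V hV hxV hVQ using key
  obtain ⟨t, ht⟩ := hP.isCompact.elim_finite_subcover V (fun x => (hV x).isOpen)
    (fun x hx => mem_iUnion.2 ⟨⟨x, hx⟩, hxV _⟩)
  exact ⟨⋃ x ∈ t, V x, t.finite_toSet.isClopen_biUnion fun x _ => hV x, ht,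
    disjoint_iUnion₂_left.2 fun x _ => hVQ x⟩

/-- If no connected subset of the fiber over `p` joins the disjoint closed sets `P` and `Q`, then
the same holds for all nearby fibers. -/
theorem isClosed_setOf_fiber_connects {X Y : Type*} [TopologicalSpace X] [T2Space X]
    [CompactSpace X] [TopologicalSpace Y] [T2Space Y] {g : X → Y} (hg : Continuous g)
    {P Q : Set X} (hP : IsClosed P) (hQ : IsClosed Q) (hPQ : Disjoint P Q) :
    IsClosed {p : Y | ∃ S ⊆ g ⁻¹' {p}, IsConnected S ∧ (S ∩ P).Nonempty ∧ (S ∩ Q).Nonempty} := by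
  rw [← isOpen_compl_iff, isOpen_iff_mem_nhds]
  intro p hp
  have hF : IsClosed (g ⁻¹' {p}) := isClosed_singleton.preimage hg
  have : CompactSpace (g ⁻¹' {p}) := isCompact_iff_compactSpace.1 hF.isCompact
  obtain ⟨V, hV, hPV, hVQ⟩ := exists_isClopen_of_forall_isConnected
    (hP.preimage (continuous_subtype_val (p := (· ∈ g ⁻¹' {p})))) (hQ.preimage
      continuous_subtype_val) (by
      rintro S hS ⟨x, hxS, hx⟩ ⟨y, hyS, hy⟩
      exact hp ⟨Subtype.val '' S, by rintro _ ⟨z, -, rfl⟩; exact z.2,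
        hS.image _ continuous_subtype_val.continuousOn, ⟨x, mem_image_of_mem _ hxS, hx⟩,
        ⟨y, mem_image_of_mem _ hyS, hy⟩⟩)
  have hV' : IsClosed (Subtype.val '' V) := hF.isClosedEmbedding_subtypeVal.isClosedMap _ hV.1
  have hVc : IsClosed (Subtype.val '' Vᶜ) :=
    hF.isClosedEmbedding_subtypeVal.isClosedMap _ hV.compl.1
  -- Adjoining all of `P` and `Q` makes a connecting set in a nearby fiber meet both open sets.
  obtain ⟨U₁, U₂, hU₁, hU₂, h₁, h₂, hU⟩ := normal_separation (hV'.union hP) (hVc.union hQ) (by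
    rw [disjoint_union_left, disjoint_union_right, disjoint_union_right]
    refine ⟨⟨?_, ?_⟩, ?_, hPQ⟩
    · exact (disjoint_image_iff Subtype.val_injective).2 disjoint_compl_right
    · rw [disjoint_left]
      rintro _ ⟨x, hx, rfl⟩ hxQ
      exact disjoint_left.1 hVQ hx hxQ
    · rw [disjoint_left]
      rintro _ hxP ⟨x, hx, rfl⟩
      exact hx (hPV hxP))
  have hK : IsClosed (g '' (U₁ ∪ U₂)ᶜ) :=
    ((hU₁.union hU₂).isClosed_compl.isCompact.image hg).isClosed
  refine Filter.mem_of_superset (hK.isOpen_compl.mem_nhds ?_) ?_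
  · rintro ⟨x, hx, rfl⟩
    by_cases hxV : (⟨x, rfl⟩ : g ⁻¹' {g x}) ∈ V
    · exact hx (Or.inl (h₁ (Or.inl ⟨_, hxV, rfl⟩)))
    · exact hx (Or.inr (h₂ (Or.inl ⟨_, hxV, rfl⟩)))
  · rintro q hq ⟨S, hSq, hS, ⟨x, hxS, hx⟩, ⟨y, hyS, hy⟩⟩
    have hSU : S ⊆ U₁ ∪ U₂ := fun z hz => by
      by_contra hzU
      exact hq ⟨z, hzU, hSq hz⟩
    obtain ⟨z, -, hz₁, hz₂⟩ := hS.isPreconnected U₁ U₂ hU₁ hU₂ hSU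
      ⟨x, hxS, h₁ (Or.inr hx)⟩ ⟨y, hyS, h₂ (Or.inr hy)⟩
    exact disjoint_left.1 hU hz₁ hz₂

/-- If a connected set avoiding the fiber over `p` joins `P` and `Q`, then so does one avoiding
all nearby fibers. -/
theorem isClosed_setOf_fiber_separates {X Y : Type*} [TopologicalSpace X]
    [LocallyPathConnectedSpace X] [TopologicalSpace Y] [T2Space Y] {g : X → Y}
    (hg : Continuous g) (P Q : Set X) :
    IsClosed {p : Y | ¬ ∃ S ⊆ (g ⁻¹' {p})ᶜ,
      IsConnected S ∧ (S ∩ P).Nonempty ∧ (S ∩ Q).Nonempty} := by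
  rw [← isOpen_compl_iff, isOpen_iff_mem_nhds]
  intro p hp
  obtain ⟨S, hSp, hS, ⟨x, hxS, hx⟩, ⟨y, hyS, hy⟩⟩ := not_not.1 hp
  have hU : IsOpen (g ⁻¹' {p})ᶜ := (isClosed_singleton.preimage hg).isOpen_compl
  have hC : IsPathConnected (connectedComponentIn (g ⁻¹' {p})ᶜ x) :=
    (hU.connectedComponentIn.isConnected_iff_isPathConnected).1
      (isConnected_connectedComponentIn_iff.2 (hSp hxS))
  obtain ⟨γ, hγ⟩ := hC.joinedIn x (mem_connectedComponentIn (hSp hxS)) y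
    (hS.isPreconnected.subset_connectedComponentIn hxS hSp hyS)
  have hK : IsClosed (g '' range γ) := ((isCompact_range γ.continuous).image hg).isClosed
  refine Filter.mem_of_superset (hK.isOpen_compl.mem_nhds ?_) fun q hq => not_not.2 ?_
  · rintro ⟨_, ⟨t, rfl⟩, ht⟩
    exact connectedComponentIn_subset _ _ (hγ t) ht
  · exact ⟨range γ, fun z hz hzq => hq ⟨z, hz, hzq⟩, isConnected_range γ.continuous,
      ⟨x, ⟨0, γ.source⟩, hx⟩, ⟨y, ⟨1, γ.target⟩, hy⟩⟩

instance unitInterval.instLocallyPathConnectedSpace : LocallyPathConnectedSpace unitInterval :=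
  (isQuotientMap_projIcc (h := zero_le_one (α := ℝ))).locallyPathConnectedSpace

/-! ### Connecting and separating faces of the cube -/

namespace UnitCube

variable {n : ℕ}

theorem isClosed_faceMinus (i : Fin n) : IsClosed (faceMinus i) :=
  isClosed_singleton.preimage (continuous_apply i)

theorem isClosed_facePlus (i : Fin n) : IsClosed (facePlus i) :=
  isClosed_singleton.preimage (continuous_apply i)

theorem disjoint_faceMinus_facePlus (i : Fin n) : Disjoint (faceMinus i) (facePlus i) :=
  disjoint_left.2 fun z (h₀ : z i = 0) (h₁ : z i = 1) => zero_ne_one (h₀.symm.trans h₁)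

theorem exists_apply_eq_of_isConnected {i : Fin n} {S : Set (UnitCube n)} (hS : IsConnected S)
    (h₀ : (S ∩ faceMinus i).Nonempty) (h₁ : (S ∩ facePlus i).Nonempty) (t : unitInterval) :
    ∃ z ∈ S, z i = t := by
  obtain ⟨x, hxS, hx⟩ := h₀
  obtain ⟨y, hyS, hy⟩ := h₁
  have := hS.isPreconnected.intermediate_value hxS hyS (continuous_apply i).continuousOn
  exact this ⟨hx.trans_le unitInterval.nonneg', unitInterval.le_one'.trans_eq hy.symm⟩

theorem connects_of_forall_update_mem {i : Fin n} {B : Set (UnitCube n)} (z : UnitCube n)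
    (h : ∀ t, Function.update z i t ∈ B) : Connects i B :=
  ⟨range (Function.update z i), range_subset_iff.2 h,
    isConnected_range (continuous_const.update i continuous_id),
    ⟨_, mem_range_self 0, Function.update_self ..⟩, ⟨_, mem_range_self 1, Function.update_self ..⟩⟩

theorem connects_univ (i : Fin n) : Connects i univ :=
  connects_of_forall_update_mem 0 fun _ => mem_univ _

theorem isCompact_connSet {Y : Type*} [TopologicalSpace Y] [T2Space Y] (i : Fin n)
    {g : UnitCube n → Y} (hg : Continuous g) : IsCompact (connSet i g) := by
  refine (isCompact_range hg).of_isClosed_subset (isClosed_setOf_fiber_connects hg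
    (isClosed_faceMinus i) (isClosed_facePlus i) (disjoint_faceMinus_facePlus i)) ?_
  rintro p ⟨S, hS, -, ⟨x, hx, -⟩, -⟩
  exact ⟨x, hS hx⟩

theorem isCompact_sepSet {Y : Type*} [TopologicalSpace Y] [T2Space Y] (i : Fin n)
    {g : UnitCube n → Y} (hg : Continuous g) : IsCompact (sepSet i g) := by
  refine (isCompact_range hg).of_isClosed_subset (isClosed_setOf_fiber_separates hg _ _) ?_
  intro p hp
  by_contra hpg
  refine hp ?_
  rw [preimage_singleton_eq_empty.2 hpg, compl_empty]
  exact connects_univ i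

/-- A horizontal segment on which `G` is constantly `p` joins the faces inside the fiber, while a
slice `z i = x` missing the fiber blocks every connection. -/
theorem connSet_comp_eq {Y : Type*} {i j : Fin n} (hij : i ≠ j) {A : Set Y}
    {G : unitInterval → unitInterval → Y} (hA : ∀ p ∈ A, ∃ y, ∀ x, G x y = p)
    (hAc : ∀ p ∉ A, ∃ x, ∀ y, G x y ≠ p) : connSet i (fun z => G (z i) (z j)) = A := by
  ext p
  refine ⟨fun ⟨S, hS, hSc, h₀, h₁⟩ => ?_, fun hp => ?_⟩
  · by_contra hp
    obtain ⟨x, hx⟩ := hAc p hp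
    obtain ⟨z, hz, rfl⟩ := exists_apply_eq_of_isConnected hSc h₀ h₁ x
    exact hx _ (hS hz)
  · obtain ⟨y, hy⟩ := hA p hp
    refine connects_of_forall_update_mem (fun _ => y) fun t => ?_
    simp [hij.symm, hy]

theorem sepSet_comp_eq {Y : Type*} {i j : Fin n} (hij : i ≠ j) {A : Set Y}
    {G : unitInterval → unitInterval → Y} (hA : ∀ p ∈ A, ∃ y, ∀ x, G x y = p)
    (hAc : ∀ p ∉ A, ∃ x, ∀ y, G x y ≠ p) : sepSet i (fun z => G (z j) (z i)) = A := by
  ext p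
  refine ⟨fun h => ?_, fun hp ⟨S, hS, hSc, h₀, h₁⟩ => ?_⟩
  · by_contra hp
    obtain ⟨x, hx⟩ := hAc p hp
    refine h (connects_of_forall_update_mem (fun _ => x) fun t => ?_)
    simp [hij.symm, hx]
  · obtain ⟨y, hy⟩ := hA p hp
    obtain ⟨z, hz, rfl⟩ := exists_apply_eq_of_isConnected hSc h₀ h₁ y
    exact hS hz (hy _)

end UnitCube
-- Affine extension over the gaps of a closed set
-- A modulus affine in `|x - c|` survives interpolation, even over a gap whose far end is not close
-- to `c`.
theorem ContinuousOn.exists_dist_le_add_mul {E : Type*} [PseudoMetricSpace E] {C : Set ℝ}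
    {f : ℝ → E} (hC : IsCompact C) (hf : ContinuousOn f C) {c : ℝ}
    (hc : c ∈ C) {ε : ℝ} (hε : 0 < ε) :
    ∃ K, 0 ≤ K ∧ ∀ x ∈ C, dist (f x) (f c) ≤ ε + K * |x - c| := by
  obtain ⟨M, hM⟩ := (hC.image_of_continuousOn hf).isBounded.subset_closedBall (f c)
  obtain ⟨δ, hδ, h⟩ := Metric.continuousOn_iff.1 hf c hc ε hε
  have hM' : ∀ x ∈ C, dist (f x) (f c) ≤ M := fun x hx => hM (mem_image_of_mem f hx)
  have hM₀ : 0 ≤ M := dist_nonneg.trans (hM' c hc)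
  refine ⟨M / δ, by positivity, fun x hx => ?_⟩
  rcases lt_or_ge |x - c| δ with hlt | hge
  · have := (h x hx hlt).le
    have : 0 ≤ M / δ * |x - c| := by positivity
    linarith
  · have : M ≤ M / δ * |x - c| := by
      rw [div_mul_eq_mul_div, le_div_iff₀ hδ]
      exact mul_le_mul_of_nonneg_left hge hM₀
    linarith [hM' x hx]

/-- The extension of `f` from a closed set `C ⊆ ℝ` that is affine on every gap of `C`. -/
noncomputable def gapExtend {E : Type*} [AddCommGroup E] [Module ℝ E] (C : Set ℝ) (f : ℝ → E)
    (y : ℝ) : E :=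
  AffineMap.lineMap (f (sSup (C ∩ Iic y))) (f (sInf (C ∩ Ici y)))
    ((y - sSup (C ∩ Iic y)) / (sInf (C ∩ Ici y) - sSup (C ∩ Iic y)))

section GapExtend

variable {E : Type*} [NormedAddCommGroup E] [NormedSpace ℝ E] {C : Set ℝ} {f : ℝ → E}

theorem gapExtend_eq {y a b : ℝ} (ha : IsGreatest (C ∩ Iic y) a) (hb : IsLeast (C ∩ Ici y) b) :
    gapExtend C f y = AffineMap.lineMap (f a) (f b) ((y - a) / (b - a)) := by
  rw [gapExtend, ha.csSup_eq, hb.csInf_eq]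

theorem gapExtend_of_mem {y : ℝ} (hy : y ∈ C) : gapExtend C f y = f y := by
  rw [gapExtend_eq (a := y) (b := y) ⟨⟨hy, self_mem_Iic⟩, fun _ h => h.2⟩
    ⟨⟨hy, self_mem_Ici⟩, fun _ h => h.2⟩]
  simp

theorem IsClosed.exists_isGreatest_inter_Iic (hC : IsClosed C) {l y : ℝ} (hl : l ∈ C)
    (hly : l ≤ y) : ∃ a, IsGreatest (C ∩ Iic y) a :=
  ⟨_, (hC.inter isClosed_Iic).isGreatest_csSup ⟨l, hl, hly⟩ ⟨y, fun _ h => h.2⟩⟩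

theorem IsClosed.exists_isLeast_inter_Ici (hC : IsClosed C) {u y : ℝ} (hu : u ∈ C)
    (hyu : y ≤ u) : ∃ b, IsLeast (C ∩ Ici y) b :=
  ⟨_, (hC.inter isClosed_Ici).isLeast_csInf ⟨u, hu, hyu⟩ ⟨y, fun _ h => h.2⟩⟩

theorem IsGreatest.inter_Iic_of_lt {y y' a b : ℝ} (ha : IsGreatest (C ∩ Iic y) a)
    (hb : IsLeast (C ∩ Ici y) b) (hy' : y' ∈ Ioo a b) : IsGreatest (C ∩ Iic y') a := by
  refine ⟨⟨ha.1.1, hy'.1.le⟩, fun c hc => ?_⟩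
  rcases le_total c y with h | h
  · exact ha.2 ⟨hc.1, h⟩
  · exact absurd (hb.2 ⟨hc.1, h⟩) (not_le.2 (lt_of_le_of_lt hc.2 hy'.2))

theorem IsLeast.inter_Ici_of_lt {y y' a b : ℝ} (ha : IsGreatest (C ∩ Iic y) a)
    (hb : IsLeast (C ∩ Ici y) b) (hy' : y' ∈ Ioo a b) : IsLeast (C ∩ Ici y') b := by
  refine ⟨⟨hb.1.1, hy'.2.le⟩, fun c hc => ?_⟩
  rcases le_total c y with h | h
  · exact absurd (ha.2 ⟨hc.1, h⟩) (not_le.2 (lt_of_lt_of_le hy'.1 hc.2))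
  · exact hb.2 ⟨hc.1, h⟩

theorem mem_Ioo_of_isGreatest_of_isLeast {y a b : ℝ} (ha : IsGreatest (C ∩ Iic y) a)
    (hb : IsLeast (C ∩ Ici y) b) (hy : y ∉ C) : y ∈ Ioo a b :=
  ⟨lt_of_le_of_ne ha.1.2 fun h => hy (h ▸ ha.1.1), lt_of_le_of_ne hb.1.2 fun h => hy (h ▸ hb.1.1)⟩

/-- The point `c` is not strictly between `a` and `b`, so `|· - c|` is affine on `[a, b]` and the
bound at the endpoints interpolates. -/
theorem dist_gapExtend_le {y c a b ε K : ℝ} (ha : IsGreatest (C ∩ Iic y) a)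
    (hb : IsLeast (C ∩ Ici y) b) (hc : c ∈ C)
    (hf : ∀ x ∈ C, dist (f x) (f c) ≤ ε + K * |x - c|) :
    dist (gapExtend C f y) (f c) ≤ ε + K * |y - c| := by
  have hay : a ≤ y := ha.1.2
  have hyb : y ≤ b := hb.1.2
  rw [gapExtend_eq ha hb]
  set t := (y - a) / (b - a) with ht
  have ht₀ : 0 ≤ t := div_nonneg (by linarith) (by linarith)
  have ht₁ : t ≤ 1 := div_le_one_of_le₀ (by linarith) (by linarith)
  have hty : t * (b - a) = y - a := by
    rcases eq_or_ne (b - a) 0 with h | h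
    · rw [h, mul_zero]; linarith
    · exact div_mul_cancel₀ _ h
  have habs : (1 - t) * |a - c| + t * |b - c| = |y - c| := by
    rcases le_total c y with h | h
    · have hca : c ≤ a := ha.2 ⟨hc, h⟩
      rw [abs_of_nonneg (by linarith), abs_of_nonneg (by linarith), abs_of_nonneg (by linarith)]
      linear_combination hty
    · have hbc : b ≤ c := hb.2 ⟨hc, h⟩
      rw [abs_of_nonpos (by linarith), abs_of_nonpos (by linarith), abs_of_nonpos (by linarith)]
      linear_combination -hty
  have hsub : AffineMap.lineMap (f a) (f b) t - f c = (1 - t) • (f a - f c) + t • (f b - f c) := by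
    rw [AffineMap.lineMap_apply_module]
    module
  calc dist (AffineMap.lineMap (f a) (f b) t) (f c)
      ≤ ‖(1 - t) • (f a - f c)‖ + ‖t • (f b - f c)‖ := by
        rw [dist_eq_norm, hsub]; exact norm_add_le _ _
    _ = (1 - t) * dist (f a) (f c) + t * dist (f b) (f c) := by
        rw [norm_smul, norm_smul, Real.norm_of_nonneg ht₀, Real.norm_of_nonneg (by linarith),
          dist_eq_norm, dist_eq_norm]
    _ ≤ (1 - t) * (ε + K * |a - c|) + t * (ε + K * |b - c|) :=
        add_le_add (mul_le_mul_of_nonneg_left (hf a ha.1.1) (by linarith))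
          (mul_le_mul_of_nonneg_left (hf b hb.1.1) ht₀)
    _ = ε + K * |y - c| := by rw [← habs]; ring

theorem continuousOn_gapExtend (hC : IsCompact C) (hf : ContinuousOn f C) {l u : ℝ} (hl : l ∈ C)
    (hu : u ∈ C) : ContinuousOn (gapExtend C f) (Icc l u) := by
  intro y hy
  by_cases hyC : y ∈ C
  · rw [Metric.continuousWithinAt_iff]
    intro ε hε
    obtain ⟨K, hK, h⟩ := hf.exists_dist_le_add_mul hC hyC (half_pos hε)
    refine ⟨ε / 2 / (K + 1), by positivity, fun x hx hxy => ?_⟩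
    obtain ⟨a, ha⟩ := hC.isClosed.exists_isGreatest_inter_Iic hl hx.1
    obtain ⟨b, hb⟩ := hC.isClosed.exists_isLeast_inter_Ici hu hx.2
    rw [gapExtend_of_mem hyC]
    have h₁ := dist_gapExtend_le ha hb hyC h
    rw [Real.dist_eq, lt_div_iff₀ (by positivity)] at hxy
    nlinarith [abs_nonneg (x - y)]
  · obtain ⟨a, ha⟩ := hC.isClosed.exists_isGreatest_inter_Iic hl hy.1
    obtain ⟨b, hb⟩ := hC.isClosed.exists_isLeast_inter_Ici hu hy.2
    have hcont : Continuous fun x : ℝ =>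
        (AffineMap.lineMap (f a) (f b) ((x - a) / (b - a)) : E) :=
      AffineMap.lineMap_continuous.comp (by fun_prop)
    refine (hcont.continuousAt.congr ?_).continuousWithinAt
    filter_upwards [isOpen_Ioo.mem_nhds (mem_Ioo_of_isGreatest_of_isLeast ha hb hyC)] with x hx
    exact (gapExtend_eq (ha.inter_Iic_of_lt hb hx) (IsLeast.inter_Ici_of_lt ha hb hx)).symm

/-- Every gap contains a rational, which recovers its endpoints; hence countably many lines suffice.
-/
theorem exists_rat_gapExtend_mem_range_lineMap (hC : IsClosed C) {l u y : ℝ} (hl : l ∈ C)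
    (hu : u ∈ C) (hy : y ∈ Icc l u) (hyC : y ∉ C) :
    ∃ q : ℚ, gapExtend C f y ∈ range (AffineMap.lineMap (k := ℝ)
      (f (sSup (C ∩ Iic (q : ℝ)))) (f (sInf (C ∩ Ici (q : ℝ))))) := by
  obtain ⟨a, ha⟩ := hC.exists_isGreatest_inter_Iic hl hy.1
  obtain ⟨b, hb⟩ := hC.exists_isLeast_inter_Ici hu hy.2
  have h := mem_Ioo_of_isGreatest_of_isLeast ha hb hyC
  obtain ⟨q, hq⟩ := exists_rat_btwn (h.1.trans h.2)
  refine ⟨q, ?_⟩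
  rw [gapExtend_eq ha hb, (ha.inter_Iic_of_lt hb hq).csSup_eq,
    (IsLeast.inter_Ici_of_lt ha hb hq).csInf_eq]
  exact mem_range_self _

end GapExtend

/-! ### The curve and the map of the square -/

theorem one_mem_cantorSet : (1 : ℝ) ∈ cantorSet := by
  refine mem_iInter.2 fun k => ?_
  induction k with
  | zero => simp
  | succ k ih => exact Or.inr ⟨1, ih, by norm_num⟩

/-- Every nonempty compact set is contained in a curve that leaves it only along countably many
segments. -/
theorem IsCompact.exists_curve_union_segments {E : Type*} [NormedAddCommGroup E] [NormedSpace ℝ E]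
    {A : Set E} (hA : IsCompact A) (hne : A.Nonempty) :
    ∃ (F : unitInterval → E) (u v : ℚ → E), Continuous F ∧ A ⊆ range F ∧
      ∀ y, F y ∈ A ∨ ∃ q, F y ∈ range (AffineMap.lineMap (k := ℝ) (u q) (v q)) := by
  have := hne.to_subtype
  have := isCompact_iff_compactSpace.1 hA
  obtain ⟨φ, hφ, hφs⟩ := exists_nat_bool_continuous_surjective_of_compact A
  let f₀ : cantorSet → E := fun c => φ (cantorSetHomeomorphNatToBool c)
  let f : ℝ → E := Function.extend Subtype.val f₀ 0
  have hf₀ : ∀ c : cantorSet, f c = f₀ c := Subtype.val_injective.extend_apply f₀ 0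
  have hf : ContinuousOn f cantorSet := by
    rw [continuousOn_iff_continuous_domRestrict, show cantorSet.domRestrict f = f₀ from funext hf₀]
    exact continuous_subtype_val.comp (hφ.comp cantorSetHomeomorphNatToBool.continuous)
  refine ⟨fun y => gapExtend cantorSet f y, fun q => f (sSup (cantorSet ∩ Iic (q : ℝ))),
    fun q => f (sInf (cantorSet ∩ Ici (q : ℝ))),
    continuousOn_iff_continuous_domRestrict.1
      (continuousOn_gapExtend isCompact_cantorSet hf zero_mem_cantorSet one_mem_cantorSet),
    fun p hp => ?_, fun y => ?_⟩
  · obtain ⟨s, hs⟩ := hφs ⟨p, hp⟩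
    obtain ⟨c, rfl⟩ := cantorSetHomeomorphNatToBool.surjective s
    refine ⟨⟨c, cantorSet_subset_unitInterval c.2⟩, ?_⟩
    simp only [gapExtend_of_mem c.2, hf₀, f₀, hs]
  · by_cases hy : (y : ℝ) ∈ cantorSet
    · left
      dsimp only
      rw [gapExtend_of_mem hy, hf₀ ⟨y, hy⟩]
      exact Subtype.coe_prop _
    · exact Or.inr (exists_rat_gapExtend_mem_range_lineMap isClosed_cantorSet zero_mem_cantorSet
        one_mem_cantorSet y.2 hy)

theorem exists_forall_notMem_span_singleton {E ι : Type*} [NormedAddCommGroup E] [NormedSpace ℝ E]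
    [FiniteDimensional ℝ E] [Countable ι] (hE : 1 < Module.finrank ℝ E) (d : ι → E) :
    ∃ h : E, ∀ k, h ∉ Submodule.span ℝ {d k} := by
  borelize E
  let μ : MeasureTheory.Measure E := MeasureTheory.Measure.addHaar
  -- Lines are Haar-null in dimension at least two, so countably many cannot cover `E`.
  have h₀ : μ (⋃ k, (Submodule.span ℝ {d k} : Set E)) = 0 :=
    MeasureTheory.measure_iUnion_null fun k =>
      MeasureTheory.Measure.addHaar_submodule μ _ fun h => 
        hE.not_ge (finrank_le_one (d k) fun w => Submodule.mem_span_singleton.1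
          (h ▸ Submodule.mem_top))
  by_contra! hall
  rw [eq_univ_of_forall fun h => mem_iUnion.2 (hall h)] at h₀
  exact MeasureTheory.Measure.measure_univ_ne_zero.2 (NeZero.ne μ) h₀

/-- Two hits of `p` differ by a multiple of `h` lying in the span of `v - u`. That multiple is zero,
so both come from the same point `w`, and `ρ w ≠ 0` cancels. -/
theorem subsingleton_setOf_lineMap_add_smul_eq {E : Type*} [AddCommGroup E] [Module ℝ E]
    {u v h : E} (hh : h ∉ Submodule.span ℝ {v - u}) (ρ : E → ℝ) (p : E) :
    {x : ℝ | ∃ t : ℝ, ρ (AffineMap.lineMap u v t) ≠ 0 ∧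
      AffineMap.lineMap u v t + (x * ρ (AffineMap.lineMap u v t)) • h = p}.Subsingleton := by
  rintro x ⟨t, ht, hx⟩ x' ⟨t', -, hx'⟩
  set w := AffineMap.lineMap u v t with hw
  set w' := AffineMap.lineMap u v t' with hw'
  have hdiff : (x * ρ w - x' * ρ w') • h = (t' - t) • (v - u) := by
    have h₁ : w' - w = (t' - t) • (v - u) := by
      rw [hw, hw', AffineMap.lineMap_apply_module, AffineMap.lineMap_apply_module]; module
    rw [← h₁, sub_smul, sub_eq_sub_iff_add_eq_add, add_comm, hx, hx']
  have hc : x * ρ w - x' * ρ w' = 0 := by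
    by_contra hc
    exact hh ((Submodule.smul_mem_iff _ hc).1
      (hdiff ▸ Submodule.smul_mem _ _ (Submodule.mem_span_singleton_self _)))
  have hww : w = w' := by
    rw [sub_eq_zero.1 hc] at hx
    exact add_right_cancel (hx.trans hx'.symm)
  rw [← hww, ← sub_mul] at hc
  exact sub_eq_zero.1 ((mul_eq_zero.1 hc).resolve_right ht)

theorem Set.Countable.exists_unitInterval_notMem {B : Set ℝ} (hB : B.Countable) :
    ∃ x : unitInterval, (x : ℝ) ∉ B := by
  obtain ⟨x, hx, hxI⟩ := (hB.dense_compl ℝ).exists_mem_open isOpen_Ioo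
    (nonempty_Ioo.2 (zero_lt_one (α := ℝ)))
  exact ⟨⟨x, Ioo_subset_Icc_self hxI⟩, hx⟩

/-- For compact `A` some map of the square is constantly `p` on a horizontal segment for each
`p ∈ A`, and avoids `p` on a vertical segment for each `p ∉ A`. -/
theorem IsCompact.exists_square_map {E : Type*} [NormedAddCommGroup E] [NormedSpace ℝ E]
    [FiniteDimensional ℝ E] (hE : 1 < Module.finrank ℝ E) {A : Set E} (hA : IsCompact A) :
    ∃ G : unitInterval → unitInterval → E, Continuous (Function.uncurry G) ∧
      (∀ p ∈ A, ∃ y, ∀ x, G x y = p) ∧ ∀ p ∉ A, ∃ x, ∀ y, G x y ≠ p := by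
  rcases A.eq_empty_or_nonempty with rfl | hne
  -- No curve is available for empty `A`; a map depending on `x` alone and taking two values
  -- suffices.
  · have : Nontrivial E := Module.nontrivial_of_finrank_pos (R := ℝ) (by omega)
    obtain ⟨e, he⟩ := exists_ne (0 : E)
    refine ⟨fun x _ => (x : ℝ) • e, by fun_prop, by simp, fun p _ => ?_⟩
    rcases eq_or_ne p 0 with rfl | hp
    · exact ⟨1, fun _ => by simpa using he⟩
    · exact ⟨0, fun _ => by simpa using hp.symm⟩
  obtain ⟨F, u, v, hF, hAF, hFseg⟩ := hA.exists_curve_union_segments hne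
  obtain ⟨h, hh⟩ := exists_forall_notMem_span_singleton hE fun q => v q - u q
  refine ⟨fun x y => F y + ((x : ℝ) * Metric.infDist (F y) A) • h, ?_, fun p hp => ?_,
    fun p hp => ?_⟩
  · have := Metric.continuous_infDist_pt A
    simp only [Function.uncurry_def]
    fun_prop
  · obtain ⟨y, rfl⟩ := hAF hp
    exact ⟨y, fun x => by simp [Metric.infDist_zero_of_mem hp]⟩
  · obtain ⟨x, hx⟩ := (countable_iUnion fun q => (subsingleton_setOf_lineMap_add_smul_eq (hh q)
      (fun w => Metric.infDist w A) p).countable).exists_unitInterval_notMem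
    refine ⟨x, fun y hy => ?_⟩
    dsimp only at hy
    by_cases hyA : F y ∈ A
    · rw [Metric.infDist_zero_of_mem hyA, mul_zero, zero_smul, add_zero] at hy
      exact hp (hy ▸ hyA)
    · obtain ⟨q, t, ht⟩ := (hFseg y).resolve_left hyA
      refine hx (mem_iUnion.2 ⟨q, t, ?_, ?_⟩)
      · rw [ht]
        exact fun h₀ => hyA ((hA.isClosed.mem_iff_infDist_zero hne).2 h₀)
      · rw [ht]
        exact hy

theorem mainTheorem9 (n m : ℕ) (hm : 1 < m) (hn : 1 < n) (i : Fin n)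
    (A : Set (EuclideanSpace ℝ (Fin m))) :
    List.TFAE [
      IsCompact A,
      ∃ g : UnitCube n → EuclideanSpace ℝ (Fin m),
        Continuous g ∧ UnitCube.connSet i g = A,
      ∃ g : UnitCube n → EuclideanSpace ℝ (Fin m),
        Continuous g ∧ UnitCube.sepSet i g = A] := by
  obtain ⟨j, hj⟩ : ∃ j : Fin n, i ≠ j := by
    have : Nontrivial (Fin n) := Fin.nontrivial_iff_two_le.2 hn
    exact (exists_ne i).imp fun _ => Ne.symm
  have hE : 1 < Module.finrank ℝ (EuclideanSpace ℝ (Fin m)) := by simpa using hm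
  tfae_have 1 → 2 := fun hA => by
    obtain ⟨G, hG, hGA, hGAc⟩ := hA.exists_square_map hE
    exact ⟨_, hG.comp ((continuous_apply i).prodMk (continuous_apply j)),
      UnitCube.connSet_comp_eq hj hGA hGAc⟩
  tfae_have 1 → 3 := fun hA => by
    obtain ⟨G, hG, hGA, hGAc⟩ := hA.exists_square_map hE
    exact ⟨_, hG.comp ((continuous_apply j).prodMk (continuous_apply i)),
      UnitCube.sepSet_comp_eq hj hGA hGAc⟩
  tfae_have 2 → 1 := fun ⟨_, hg, hgA⟩ => hgA ▸ UnitCube.isCompact_connSet i hg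
  tfae_have 3 → 1 := fun ⟨_, hg, hgA⟩ => hgA ▸ UnitCube.isCompact_sepSet i hg
  tfae_finish
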